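/- Let $Q_1=\chi_{[0,1)}$ and $Q_{m+1}(t)=\int_{\mathbb R}Q_m(t-y)Q_1(y)\,dy$ be the B-splines, and for a compactly supported $C^{\rho-1}$ function $\phi$ let $V(\phi)=\{f\in L^2(\mathbb R): f(x)=\sum_{k\in\mathbb Z}c_k\phi(x-k),\ (c_k)\in\ell^2(\mathbb Z)\}$. For $\kappa=(\phi,a,\rho)$ let $\Psi_\kappa(t)$ be the $\rho\times\rho$ matrix with entries $\Psi_\kappa^{ij}(t)=\sum_{k\in\mathbb Z}\phi^{(i)}(a+\rho k-j)e^{2\pi \mathrm i kt}$, $0\le i,j\le\rho-1$, and put $$\Theta_{i,\kappa}(t)=\sum_{v\in\mathbb Z}\sum_{j=0}^{\rho-1}\widehat{(\Psi_\kappa^{-1})^{ji}}(v)\,\phi(t-\rho v-j),\qquad (S_W^\kappa f)(t)=\sum_{l\in\mathbb Z}\sum_{i=0}^{\rho-1}\frac1{W^i}f^{(i)}\Big(\frac{a+\rho l}{W}\Big)\Theta_{i,\kappa}(Wt-\rho l),$$ where $\widehat g(v)=\int_0^1 g(t)e^{-2\pi \mathrm i vt}\,dt$. For $r\in\mathbb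 N$, $1\le p<\infty$, $\delta\ge 0$ let $\omega_r(f;x;\delta)=\sup\{|\sum_{j=0}^r(-1)^{r-j}\binom rj f(t+jh)|: t,\,t+rh\in[x-\frac{r\delta}2,x+\frac{r\delta}2]\}$ and $\tau_r(f,\delta)_p=\|\omega_r(f;\bullet;\delta)\|_{L^p(\mathbb R)}$. A real sequence $(x_j)_{j\in\mathbb Z}$ is admissible if $0<\inf_j(x_j-x_{j-1})\le\sup_j(x_j-x_{j-1})<\infty$. Let $\Lambda_\rho^p$ be the set of bounded measurable functions $f:\mathbb R\to\mathbb C$ such that, for every admissible sequence $(x_j)$, $f$ is $(\rho-1)$ times differentiable at the points $x_j$ and $\sum_{j}\sum_{i=0}^{\rho-1}|f^{(i)}(x_j)|^p(x_j-x_{j-1})<\infty$. Corollary. Let $\kappa=(Q_3,0,2)$. (i) $\Theta_{0,\kappa}(t)=Q_3(t+2)+Q_3(t+1)$ and $\Theta_{1,\kappa}(t)=-\frac12Q_3(t+2)+\frac12Q_3(t+1)$ for all $t\in\mathbb R$. (ii) Every $f\in V(Q_3)$ (given pointwise by its expansion) is differentiable, and $f(t)=\sum_{l\in\mathbb Z}\sum_{i=0}^{1}f^{(i)}(2l)\,\Theta_{i,\kappa}(t-2l)$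 for all $t\in\mathbb R$. (iii) For every polynomial $P$ of degree at most $2$ and every $W>0$, $S_W^\kappa P=P$ on $\mathbb R$. (iv) Let $1\le p<\infty$ and $\alpha>0$. If $f\in\Lambda_2^p$ and $\tau_2(f^{(i)},\delta)_p=\mathcal O(\delta^\alpha)$ as $\delta\to0+$ for $i=0,1$, then $S_W^\kappa f-f\in L^p(\mathbb R)$ for all large $W$, and $\|S_W^\kappa f-f\|_{L^p(\mathbb R)}=\mathcal O(W^{-\alpha})$ as $W\to\infty$. -/

import Mathlib

open MeasureTheory Filter Topology
open scoped ENNReal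

noncomputable section

namespace DerivSampling

/-- The cardinal B-splines: `Q 1` is the indicator function of `[0, 1)` and
`Q (m + 1) t = ∫ y, Q m (t - y) * Q 1 y` for `m ≥ 1`. The index `0` is not used. -/
def Q : ℕ → ℝ → ℝ
  | 0 => fun _ => 0
  | 1 => Set.indicator (Set.Ico (0 : ℝ) 1) (fun _ => 1)
  | (m + 2) => fun t =>
      ∫ y : ℝ, Q (m + 1) (t - y) * Set.indicator (Set.Ico (0 : ℝ) 1) (fun _ => 1) y

/-- The shift-invariant space `V(φ)`, with its elements taken as the functions given pointwise
by the expansion in the integer shifts of `φ`. -/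
def shiftInvariantSpace (φ : ℝ → ℝ) : Set (ℝ → ℂ) :=
  {f | MemLp f 2 volume ∧ ∃ c : ℤ → ℂ, Memℓp c 2 ∧
    ∀ x : ℝ, HasSum (fun k : ℤ => c k * (φ (x - k) : ℂ)) (f x)}

/-- The symbol `Ψ_κ(t)` for `κ = (φ, a, ρ)`: the `ρ × ρ` matrix with entries
`∑ₖ φ⁽ⁱ⁾(a + ρ k - j) exp(2 π i k t)`. -/
def symbol (φ : ℝ → ℝ) (a : ℝ) (ρ : ℕ) (t : ℝ) : Matrix (Fin ρ) (Fin ρ) ℂ :=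
  Matrix.of fun i j => ∑' k : ℤ,
    ((iteratedDeriv (i : ℕ) φ (a + ρ * k - (j : ℕ)) : ℝ) : ℂ) *
      Complex.exp (2 * Real.pi * Complex.I * k * t)

/-- The `v`-th Fourier coefficient of the matrix function `t ↦ Ψ_κ(t)⁻¹` on `[0, 1]`. -/
def symbolInvCoeff (φ : ℝ → ℝ) (a : ℝ) (ρ : ℕ) (v : ℤ) : Matrix (Fin ρ) (Fin ρ) ℂ :=
  Matrix.of fun i j => ∫ t in (0 : ℝ)..1,
    Complex.exp (-(2 * Real.pi * Complex.I * v * t)) * (symbol φ a ρ t)⁻¹ i j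

/-- The reconstruction functions
`Θ_{i,κ}(t) = ∑ᵥ ∑ⱼ (Ψ_κ⁻¹)^{ji}-Fourier coefficient at v, times φ(t - ρ v - j)`. -/
def reconstruction (φ : ℝ → ℝ) (a : ℝ) (ρ : ℕ) (i : Fin ρ) (t : ℝ) : ℂ :=
  ∑' v : ℤ, ∑ j : Fin ρ, symbolInvCoeff φ a ρ v j i * (φ (t - ρ * v - (j : ℕ)) : ℂ)

/-- The derivative sampling operator
`(S_W f)(t) = ∑ₗ ∑ᵢ W⁻ⁱ f⁽ⁱ⁾((a + ρ l) / W) Θ_{i,κ}(W t - ρ l)`. -/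
def samplingOperator (φ : ℝ → ℝ) (a : ℝ) (ρ : ℕ) (W : ℝ) (f : ℝ → ℂ) (t : ℝ) : ℂ :=
  ∑' l : ℤ, ∑ i : Fin ρ, (1 / (W : ℂ) ^ (i : ℕ)) * iteratedDeriv (i : ℕ) f ((a + ρ * l) / W) *
    reconstruction φ a ρ i (W * t - ρ * l)

/-- The forward difference `(Δ_h^r f)(t)`. -/
def forwardDiff (r : ℕ) (h : ℝ) (f : ℝ → ℂ) (t : ℝ) : ℂ :=
  ∑ j ∈ Finset.range (r + 1), (-1 : ℂ) ^ (r - j) * (r.choose j : ℂ) * f (t + j * h)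

/-- The local modulus of smoothness `ω_r(f; x; δ)`, as an extended nonnegative number. -/
def localModulus (r : ℕ) (f : ℝ → ℂ) (x δ : ℝ) : ℝ≥0∞ :=
  ⨆ (t : ℝ) (h : ℝ) (_ : t ∈ Set.Icc (x - r * δ / 2) (x + r * δ / 2))
    (_ : t + r * h ∈ Set.Icc (x - r * δ / 2) (x + r * δ / 2)), ‖forwardDiff r h f t‖ₑ

/-- The `L^p`-averaged modulus of smoothness `τ_r(f; δ)_p`. -/
def averagedModulus (r : ℕ) (f : ℝ → ℂ) (δ p : ℝ) : ℝ≥0∞ :=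
  eLpNorm (fun x => localModulus r f x δ) (ENNReal.ofReal p) volume

/-- Admissible partitions of the line: the mesh sizes are bounded away from `0` and from `∞`. -/
def IsAdmissible (x : ℤ → ℝ) : Prop :=
  ∃ d D : ℝ, 0 < d ∧ ∀ j : ℤ, d ≤ x j - x (j - 1) ∧ x j - x (j - 1) ≤ D

/-- The discrete norm of `f` and its derivatives of order less than `ρ` on the partition `x`. -/
def discreteNorm (ρ : ℕ) (p : ℝ) (x : ℤ → ℝ) (f : ℝ → ℂ) : ℝ≥0∞ :=
  (∑' j : ℤ, ∑ i ∈ Finset.range ρ,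
    ‖iteratedDeriv i f (x j)‖ₑ ^ p * ENNReal.ofReal (x j - x (j - 1))) ^ (1 / p)

/-- The space `Λ_ρ^p`: bounded measurable functions which, on every admissible partition, are
`ρ - 1` times differentiable and have finite discrete norm. -/
def Lam (ρ : ℕ) (p : ℝ) : Set (ℝ → ℂ) :=
  {f | AEStronglyMeasurable f volume ∧ (∃ M : ℝ, ∀ t, ‖f t‖ ≤ M) ∧
    ∀ x : ℤ → ℝ, IsAdmissible x →
      (∀ j : ℤ, ∀ i : ℕ, i + 1 < ρ → DifferentiableAt ℝ (iteratedDeriv i f) (x j)) ∧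
      discreteNorm ρ p x f < ∞}

end DerivSampling

end

open DerivSampling

namespace DerivSampling

/-! At integers, `Q 3` has nonzero value or slope only at 1 and 2, and among the points 2k - j with
j = 0, 1 these occur only for k = 1. So the symbol is exp(2πit) times a constant invertible matrix,
its inverse has a single Fourier coefficient, at v = -1, and each reconstruction function combines
two shifts of `Q 3` and is supported in [-2, 2].

Hence on a cell [2m/W, (2m+2)/W] the operator sees only the values and slopes of f at the two ends:
it is Hermite interpolation by quadratic splines with one knot at the midpoint
(`samplingOperator_Q_three`). Quadratics are reproduced, and in the spline space the data at each
node return two of the four coefficients active on a cell.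

For the rate, subtract from f the quadratic q with the same value at the left end and the same
slopes at both ends. As q' is affine, f' - q' has the second differences of f'; it vanishes at both
ends, so Whitney's inequality (`norm_le_of_secondDiff`) bounds it by their supremum ω, and
integration bounds f - q by ω times the cell length. This gives a pointwise error of at most (4/W)
ω₂(f'; t; 2/W), and taking L^p norms finishes. -/

/-! ### The quadratic B-spline and its values and slopes at the integers -/

theorem Q_succ_succ_eq_intervalIntegral (m : ℕ) (t : ℝ) :
    Q (m + 2) t = ∫ y in (t - 1)..t, Q (m + 1) y := by
  have h1 : Q (m + 2) t = ∫ y in (0 : ℝ)..1, Q (m + 1) (t - y) := by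
    rw [intervalIntegral.integral_of_le zero_le_one, ← integral_Ico_eq_integral_Ioc,
      ← integral_indicator measurableSet_Ico]
    simp only [Q]
    congr 1
    ext y
    by_cases hy : y ∈ Set.Ico (0 : ℝ) 1 <;> simp [hy]
  rw [h1, intervalIntegral.integral_comp_sub_left (fun y => Q (m + 1) y) t, sub_zero]

theorem Q_two (t : ℝ) : Q 2 t = max t 0 - 2 * max (t - 1) 0 + max (t - 2) 0 := by
  rw [Q_succ_succ_eq_intervalIntegral 0 t, intervalIntegral.integral_of_le (by linarith)]
  have h1 : (Q (0 + 1) : ℝ → ℝ) = Set.indicator (Set.Ico (0 : ℝ) 1) (fun _ => 1) := rfl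
  rw [h1, setIntegral_indicator measurableSet_Ico,
    setIntegral_congr_set ((ae_eq_refl (Set.Ioc (t - 1) t)).inter Ico_ae_eq_Ioc),
    Set.Ioc_inter_Ioc]
  simp only [integral_const, smul_eq_mul, mul_one, measureReal_restrict_apply_univ,
    Real.volume_real_Ioc]
  rcases le_total t 0 with h | h <;> rcases le_total t 1 with h' | h' <;>
    rcases le_total t 2 with h'' | h'' <;>
    simp [max_def, min_def] <;> (repeat' split_ifs) <;> linarith

/-- The truncated square `t ↦ (t₊)²`. -/
def posSq (t : ℝ) : ℝ := max t 0 ^ 2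

theorem posSq_of_nonneg {t : ℝ} (h : 0 ≤ t) : posSq t = t ^ 2 := by
  rw [posSq, max_eq_left h]

theorem posSq_of_nonpos {t : ℝ} (h : t ≤ 0) : posSq t = 0 := by
  rw [posSq, max_eq_right h]; norm_num

theorem hasDerivAt_posSq (t : ℝ) : HasDerivAt posSq (2 * max t 0) t := by
  rcases lt_trichotomy t 0 with h | rfl | h
  · rw [max_eq_right h.le, mul_zero]
    refine (hasDerivAt_const t (0 : ℝ)).congr_of_eventuallyEq ?_
    filter_upwards [Iio_mem_nhds h] with s hs using posSq_of_nonpos (le_of_lt hs)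
  · rw [hasDerivAt_iff_isLittleO]
    have h2 : (fun x : ℝ => x ^ 2) =o[𝓝 0] fun x => x := by
      simpa using Asymptotics.isLittleO_pow_pow (𝕜 := ℝ) (m := 1) (n := 2) (by norm_num)
    refine Asymptotics.IsBigO.trans_isLittleO ?_ (by simpa using h2)
    refine Asymptotics.IsBigO.of_bound 1 (Eventually.of_forall fun x => ?_)
    rcases le_total x 0 with hx | hx
    · simp [posSq_of_nonpos hx, posSq_of_nonpos le_rfl]; positivity
    · simp [posSq_of_nonneg hx, posSq_of_nonpos le_rfl]
  · rw [max_eq_left h.le]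
    refine (by simpa using hasDerivAt_pow 2 t : HasDerivAt (fun s : ℝ => s ^ 2) (2 * t) t
      ).congr_of_eventuallyEq ?_
    filter_upwards [Ioi_mem_nhds h] with s hs using posSq_of_nonneg (le_of_lt hs)

theorem hasDerivAt_posSq_sub (c t : ℝ) :
    HasDerivAt (fun s => posSq (s - c)) (2 * max (t - c) 0) t :=
  (hasDerivAt_posSq (t - c)).comp_sub_const t c

/-- Half the second backward difference of `posSq` is an antiderivative of `Q 2`; one more backward
difference gives the moving average. -/
theorem Q_three (t : ℝ) :
    Q 3 t = (posSq t - 3 * posSq (t - 1) + 3 * posSq (t - 2) - posSq (t - 3)) / 2 := by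
  rw [Q_succ_succ_eq_intervalIntegral 1 t]
  have hder : ∀ x ∈ Set.uIcc (t - 1) t, HasDerivAt
      (fun s => (posSq s - 2 * posSq (s - 1) + posSq (s - 2)) / 2) (Q (1 + 1) x) x := by
    intro x _
    convert! (((hasDerivAt_posSq x).sub ((hasDerivAt_posSq_sub 1 x).const_mul 2)).add
      (hasDerivAt_posSq_sub 2 x)).div_const 2 using 1
    rw [show 1 + 1 = 2 from rfl, Q_two]
    ring
  have hcont : Continuous (Q (1 + 1)) := by
    rw [show Q (1 + 1) = _ from funext Q_two]
    fun_prop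
  rw [intervalIntegral.integral_eq_sub_of_hasDerivAt hder (hcont.intervalIntegrable _ _)]
  rw [show t - 1 - 1 = t - 2 by ring, show t - 1 - 2 = t - 3 by ring]
  ring

theorem hasDerivAt_Q_three (t : ℝ) : HasDerivAt (Q 3)
    (max t 0 - 3 * max (t - 1) 0 + 3 * max (t - 2) 0 - max (t - 3) 0) t := by
  rw [show Q 3 = _ from funext Q_three]
  convert! ((((hasDerivAt_posSq t).sub ((hasDerivAt_posSq_sub 1 t).const_mul 3)).add
      ((hasDerivAt_posSq_sub 2 t).const_mul 3)).sub (hasDerivAt_posSq_sub 3 t)).div_const 2 using 1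
  ring

theorem deriv_Q_three (t : ℝ) :
    deriv (Q 3) t = max t 0 - 3 * max (t - 1) 0 + 3 * max (t - 2) 0 - max (t - 3) 0 :=
  (hasDerivAt_Q_three t).deriv

theorem continuous_Q_three : Continuous (Q 3) :=
  continuous_iff_continuousAt.2 fun t => (hasDerivAt_Q_three t).continuousAt

theorem Q_three_of_nonpos {t : ℝ} (h : t ≤ 0) : Q 3 t = 0 := by
  rw [Q_three, posSq_of_nonpos h, posSq_of_nonpos (by linarith), posSq_of_nonpos (by linarith),
    posSq_of_nonpos (by linarith)]
  ring

theorem Q_three_of_three_le {t : ℝ} (h : 3 ≤ t) : Q 3 t = 0 := by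
  rw [Q_three, posSq_of_nonneg (by linarith), posSq_of_nonneg (by linarith),
    posSq_of_nonneg (by linarith), posSq_of_nonneg (by linarith)]
  ring

theorem Q_three_of_mem_Icc_zero_one {t : ℝ} (h : 0 ≤ t) (h' : t ≤ 1) : Q 3 t = t ^ 2 / 2 := by
  rw [Q_three, posSq_of_nonneg h, posSq_of_nonpos (by linarith), posSq_of_nonpos (by linarith),
    posSq_of_nonpos (by linarith)]
  ring

theorem Q_three_of_mem_Icc_one_two {t : ℝ} (h : 1 ≤ t) (h' : t ≤ 2) :
    Q 3 t = (-2 * t ^ 2 + 6 * t - 3) / 2 := by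
  rw [Q_three, posSq_of_nonneg (by linarith), posSq_of_nonneg (by linarith),
    posSq_of_nonpos (by linarith), posSq_of_nonpos (by linarith)]
  ring

theorem Q_three_of_mem_Icc_two_three {t : ℝ} (h : 2 ≤ t) (h' : t ≤ 3) :
    Q 3 t = (3 - t) ^ 2 / 2 := by
  rw [Q_three, posSq_of_nonneg (by linarith), posSq_of_nonneg (by linarith),
    posSq_of_nonneg (by linarith), posSq_of_nonpos (by linarith)]
  ring

theorem Q_three_intCast (n : ℤ) : Q 3 n = if n = 1 ∨ n = 2 then 1 / 2 else 0 := by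
  split_ifs with h
  · rcases h with rfl | rfl
    · rw [Q_three_of_mem_Icc_zero_one (by simp) (by simp)]; norm_num
    · rw [Q_three_of_mem_Icc_two_three (by simp) (by norm_num)]; norm_num
  · rcases (by omega : n ≤ 0 ∨ 3 ≤ n) with h' | h'
    · exact Q_three_of_nonpos (by exact_mod_cast h')
    · exact Q_three_of_three_le (by exact_mod_cast h')

theorem deriv_Q_three_intCast (n : ℤ) :
    deriv (Q 3) n = if n = 1 then 1 else if n = 2 then -1 else 0 := by
  rw [deriv_Q_three]
  split_ifs with h h
  · subst h; norm_num
  · subst h; norm_num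
  · rcases (by omega : n ≤ 0 ∨ 3 ≤ n) with h' | h'
    · have : (n : ℝ) ≤ 0 := by exact_mod_cast h'
      rw [max_eq_right this, max_eq_right (by linarith), max_eq_right (by linarith),
        max_eq_right (by linarith)]
      ring
    · have : (3 : ℝ) ≤ n := by exact_mod_cast h'
      rw [max_eq_left (by linarith), max_eq_left (by linarith), max_eq_left (by linarith),
        max_eq_left (by linarith)]
      ring

/-! ### The symbol, its inverse and the reconstruction functions -/

theorem iteratedDeriv_Q_three_eq_zero (i : Fin 2) {n : ℤ} (h1 : n ≠ 1) (h2 : n ≠ 2) :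
    iteratedDeriv (i : ℕ) (Q 3) n = 0 := by
  fin_cases i
  · simp [Q_three_intCast, h1, h2]
  · simp [deriv_Q_three_intCast, h1, h2]

theorem symbol_Q_three (t : ℝ) : symbol (Q 3) 0 2 t =
    Complex.exp (2 * Real.pi * Complex.I * t) • !![1 / 2, 1 / 2; -1, 1] := by
  have key : ∀ i j : Fin 2, symbol (Q 3) 0 2 t i j =
      ((iteratedDeriv (i : ℕ) (Q 3) ((2 - (j : ℕ) : ℤ) : ℝ) : ℝ) : ℂ) *
        Complex.exp (2 * Real.pi * Complex.I * t) := by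
    intro i j
    have harg : ∀ k : ℤ, (0 + ((2 : ℕ) : ℝ) * k - ((j : ℕ) : ℝ)) = ((2 * k - (j : ℕ) : ℤ) : ℝ) := by
      intro k; push_cast; ring
    simp only [symbol, Matrix.of_apply]
    -- The sample point 2k - j lies in {1, 2} only for k = 1, because j is 0 or 1.
    rw [tsum_eq_single (1 : ℤ)]
    · rw [harg]; simp
    · intro k hk
      have hj := j.isLt
      rw [harg, iteratedDeriv_Q_three_eq_zero i (by omega) (by omega)]
      simp
  ext i j
  rw [key]
  have e1 := Q_three_intCast 1
  have e2 := Q_three_intCast 2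
  have d1 := deriv_Q_three_intCast 1
  have d2 := deriv_Q_three_intCast 2
  norm_num at e1 e2 d1 d2
  fin_cases i <;> fin_cases j <;> norm_num [e1, e2, d1, d2] <;> ring

theorem symbol_Q_three_inv (t : ℝ) : (symbol (Q 3) 0 2 t)⁻¹ =
    Complex.exp (-(2 * Real.pi * Complex.I * t)) • !![1, -(1 / 2); 1, 1 / 2] := by
  refine Matrix.inv_eq_right_inv ?_
  rw [symbol_Q_three, Matrix.smul_mul, Matrix.mul_smul, smul_smul, ← Complex.exp_add]
  ext i j
  fin_cases i <;> fin_cases j <;> norm_num [Matrix.mul_apply, Fin.sum_univ_two]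

theorem integral_exp_two_pi_int (n : ℤ) :
    ∫ t in (0 : ℝ)..1, Complex.exp (2 * Real.pi * Complex.I * n * t) = if n = 0 then 1 else 0 := by
  split_ifs with h
  · simp [h]
  · have hc : (2 * Real.pi * Complex.I * n : ℂ) ≠ 0 := by
      simp [h, Real.pi_ne_zero]
    rw [integral_exp_mul_complex hc]
    rw [show (2 * Real.pi * Complex.I * n * ((1 : ℝ) : ℂ) : ℂ) = n * (2 * Real.pi * Complex.I) by
      push_cast; ring, Complex.exp_int_mul_two_pi_mul_I]
    simp

theorem symbolInvCoeff_Q_three (v : ℤ) (i j : Fin 2) : symbolInvCoeff (Q 3) 0 2 v i j =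
    if v = -1 then !![1, -(1 / 2); 1, 1 / 2] i j else 0 := by
  have h : ∀ t : ℝ, Complex.exp (-(2 * Real.pi * Complex.I * v * t)) *
      (symbol (Q 3) 0 2 t)⁻¹ i j =
      Complex.exp (2 * Real.pi * Complex.I * ((-1 - v : ℤ) : ℂ) * t) *
        (!![1, -(1 / 2); 1, 1 / 2] : Matrix (Fin 2) (Fin 2) ℂ) i j := by
    intro t
    rw [symbol_Q_three_inv, Matrix.smul_apply, smul_eq_mul, ← mul_assoc, ← Complex.exp_add]
    congr 2
    push_cast; ring
  simp only [symbolInvCoeff, Matrix.of_apply, h]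
  rw [intervalIntegral.integral_mul_const, integral_exp_two_pi_int]
  by_cases hv : v = -1
  · subst hv; simp
  · rw [if_neg (by omega), if_neg hv, zero_mul]

theorem reconstruction_Q_three (i : Fin 2) (t : ℝ) : reconstruction (Q 3) 0 2 i t =
    (!![1, -(1 / 2); 1, 1 / 2] : Matrix (Fin 2) (Fin 2) ℂ) 0 i * (Q 3 (t + 2) : ℂ) +
    (!![1, -(1 / 2); 1, 1 / 2] : Matrix (Fin 2) (Fin 2) ℂ) 1 i * (Q 3 (t + 1) : ℂ) := by
  rw [reconstruction, tsum_eq_single (-1 : ℤ)]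
  · simp only [Fin.sum_univ_two, symbolInvCoeff_Q_three, if_true]
    congr 4 <;> norm_num
    ring
  · intro v hv
    simp [symbolInvCoeff_Q_three, hv]

theorem reconstruction_zero_Q_three (t : ℝ) :
    reconstruction (Q 3) 0 2 0 t = ((Q 3 (t + 2) + Q 3 (t + 1) : ℝ) : ℂ) := by
  rw [reconstruction_Q_three]
  simp

theorem reconstruction_one_Q_three (t : ℝ) : reconstruction (Q 3) 0 2 1 t =
    ((-(1 / 2) * Q 3 (t + 2) + 1 / 2 * Q 3 (t + 1) : ℝ) : ℂ) := by
  rw [reconstruction_Q_three]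
  simp

/-- Vanishing at ±2 themselves is included, so that the two-term formula below holds on closed
cells. -/
theorem reconstruction_Q_three_eq_zero (i : Fin 2) {x : ℝ} (h : x ≤ -2 ∨ 2 ≤ x) :
    reconstruction (Q 3) 0 2 i x = 0 := by
  have h2 : Q 3 (x + 2) = 0 := by
    rcases h with h | h
    · exact Q_three_of_nonpos (by linarith)
    · exact Q_three_of_three_le (by linarith)
  have h1 : Q 3 (x + 1) = 0 := by
    rcases h with h | h
    · exact Q_three_of_nonpos (by linarith)
    · exact Q_three_of_three_le (by linarith)
  rw [reconstruction_Q_three, h1, h2]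
  simp

/-- On `[2m, 2m + 2]` only two shifts of the reconstruction functions are active. -/
theorem hasSum_reconstruction_Q_three (a : ℤ → Fin 2 → ℂ) {m : ℤ} {x : ℝ}
    (h : 2 * (m : ℝ) ≤ x) (h' : x ≤ 2 * m + 2) :
    HasSum (fun l : ℤ => ∑ i : Fin 2, a l i * reconstruction (Q 3) 0 2 i (x - 2 * l))
      (∑ i : Fin 2, a m i * reconstruction (Q 3) 0 2 i (x - 2 * m) +
        ∑ i : Fin 2, a (m + 1) i * reconstruction (Q 3) 0 2 i (x - 2 * m - 2)) := by
  have key := hasSum_sum_of_ne_finset_zero (s := {m, m + 1})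
    (L := .unconditional ℤ) (f := fun l : ℤ => ∑ i : Fin 2, a l i * reconstruction (Q 3) 0 2 i (x - 2 * l)) ?_
  · rw [Finset.sum_pair (by omega)] at key
    convert! key using 5
    push_cast; ring_nf
  · intro l hl
    refine Finset.sum_eq_zero fun i _ => ?_
    rw [reconstruction_Q_three_eq_zero i, mul_zero]
    simp only [Finset.mem_insert, Finset.mem_singleton, not_or] at hl
    rcases (by omega : l + 1 ≤ m ∨ m + 2 ≤ l) with hl' | hl'
    · have : (l : ℝ) + 1 ≤ m := by exact_mod_cast hl'
      right; linarith
    · have : (m : ℝ) + 2 ≤ l := by exact_mod_cast hl'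
      left; linarith

/-! ### Reconstruction in the spline space -/

section ShiftInvariant

variable {c : ℤ → ℂ} {f : ℝ → ℂ}

theorem eq_sum_Icc_of_hasSum_Q_three
    (hf : ∀ x : ℝ, HasSum (fun k : ℤ => c k * (Q 3 (x - k) : ℂ)) (f x))
    {p q : ℤ} {x : ℝ} (hp : (p : ℝ) + 2 ≤ x) (hq : x ≤ q + 1) :
    f x = ∑ k ∈ Finset.Icc p q, c k * (Q 3 (x - k) : ℂ) := by
  refine (hf x).unique (hasSum_sum_of_ne_finset_zero fun k hk => ?_)
  rw [Finset.mem_Icc, not_and_or, not_le, not_le] at hk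
  have : Q 3 (x - k) = 0 := by
    rcases hk with hk | hk
    · have : (k : ℝ) + 1 ≤ p := by exact_mod_cast hk
      exact Q_three_of_three_le (by linarith)
    · have : (q : ℝ) + 1 ≤ k := by exact_mod_cast hk
      exact Q_three_of_nonpos (by linarith)
  rw [this]; simp

/-- Under the strict inequalities one finite window of coefficients represents f on a whole
neighbourhood of x, so the series is differentiated as a finite sum. -/
theorem hasDerivAt_of_hasSum_Q_three
    (hf : ∀ x : ℝ, HasSum (fun k : ℤ => c k * (Q 3 (x - k) : ℂ)) (f x))
    {p q : ℤ} {x : ℝ} (hp : (p : ℝ) + 2 < x) (hq : x < q + 1) :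
    HasDerivAt f (∑ k ∈ Finset.Icc p q, c k * ((deriv (Q 3) (x - k) : ℝ) : ℂ)) x := by
  have h1 : HasDerivAt (fun y : ℝ => ∑ k ∈ Finset.Icc p q, c k * (Q 3 (y - k) : ℂ))
      (∑ k ∈ Finset.Icc p q, c k * ((deriv (Q 3) (x - k) : ℝ) : ℂ)) x := by
    refine HasDerivAt.fun_sum fun k _ => HasDerivAt.const_mul (c k) ?_
    have := (hasDerivAt_Q_three (x - k)).comp_sub_const x (k : ℝ)
    rw [← deriv_Q_three] at this
    exact this.ofReal_comp
  refine h1.congr_of_eventuallyEq ?_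
  filter_upwards [Ioo_mem_nhds hp hq] with y hy
  exact eq_sum_Icc_of_hasSum_Q_three hf hy.1.le hy.2.le

theorem differentiable_of_hasSum_Q_three
    (hf : ∀ x : ℝ, HasSum (fun k : ℤ => c k * (Q 3 (x - k) : ℂ)) (f x)) :
    Differentiable ℝ f := fun x =>
  (hasDerivAt_of_hasSum_Q_three (p := ⌊x⌋ - 3) (q := ⌊x⌋) hf
    (by push_cast; linarith [Int.floor_le x]) (Int.lt_floor_add_one x)).differentiableAt

theorem sum_Icc_add_three (g : ℤ → ℂ) (p : ℤ) :
    ∑ k ∈ Finset.Icc p (p + 3), g k = g p + g (p + 1) + g (p + 2) + g (p + 3) := by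
  have : Finset.Icc p (p + 3) = {p, p + 1, p + 2, p + 3} := by
    ext k; simp only [Finset.mem_Icc, Finset.mem_insert, Finset.mem_singleton]; omega
  rw [this, Finset.sum_insert (by simp), Finset.sum_insert (by simp),
    Finset.sum_pair (by simp)]
  ring

theorem apply_even_of_hasSum_Q_three
    (hf : ∀ x : ℝ, HasSum (fun k : ℤ => c k * (Q 3 (x - k) : ℂ)) (f x)) (l : ℤ) :
    f (2 * l) = (c (2 * l - 2) + c (2 * l - 1)) / 2 := by
  rw [eq_sum_Icc_of_hasSum_Q_three (p := 2 * l - 3) (q := 2 * l - 3 + 3) hf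
    (by push_cast; linarith) (by push_cast; linarith), sum_Icc_add_three]
  have e : ∀ k : ℤ, (2 * (l : ℝ) - k) = ((2 * l - k : ℤ) : ℝ) := fun k => by push_cast; ring
  simp only [e, Q_three_intCast]
  ring_nf
  norm_num

theorem deriv_even_of_hasSum_Q_three
    (hf : ∀ x : ℝ, HasSum (fun k : ℤ => c k * (Q 3 (x - k) : ℂ)) (f x)) (l : ℤ) :
    deriv f (2 * l) = c (2 * l - 1) - c (2 * l - 2) := by
  rw [(hasDerivAt_of_hasSum_Q_three (p := 2 * l - 3) (q := 2 * l - 3 + 3) hf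
    (by push_cast; linarith) (by push_cast; linarith)).deriv, sum_Icc_add_three]
  have e : ∀ k : ℤ, (2 * (l : ℝ) - k) = ((2 * l - k : ℤ) : ℝ) := fun k => by push_cast; ring
  simp only [e, deriv_Q_three_intCast]
  ring_nf
  norm_num

/-- On [2m, 2m + 2] only the coefficients with indices 2m - 2, ..., 2m + 1 act. The first two have
mean f(2m) and difference f'(2m), the last two likewise at 2m + 2, so the Hermite data determine all
four. -/
theorem hasSum_reconstruction_of_hasSum_Q_three
    (hf : ∀ x : ℝ, HasSum (fun k : ℤ => c k * (Q 3 (x - k) : ℂ)) (f x)) (t : ℝ) :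
    HasSum (fun l : ℤ => ∑ i : Fin 2,
      iteratedDeriv (i : ℕ) f (2 * l) * reconstruction (Q 3) 0 2 i (t - 2 * l)) (f t) := by
  have hm : (⌊t / 2⌋ : ℝ) ≤ t / 2 := Int.floor_le _
  have hm' : t / 2 < ⌊t / 2⌋ + 1 := Int.lt_floor_add_one _
  set m := ⌊t / 2⌋
  convert! hasSum_reconstruction_Q_three
    (fun l i => iteratedDeriv (i : ℕ) f (2 * (l : ℝ))) (m := m) (x := t)
    (by linarith) (by linarith) using 1
  rw [eq_sum_Icc_of_hasSum_Q_three (p := 2 * m - 2) (q := 2 * m - 2 + 3) hf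
    (by push_cast; linarith) (by push_cast; linarith), sum_Icc_add_three]
  simp only [Fin.sum_univ_two, Fin.val_zero, Fin.val_one, iteratedDeriv_zero, iteratedDeriv_one,
    apply_even_of_hasSum_Q_three hf, deriv_even_of_hasSum_Q_three hf,
    reconstruction_zero_Q_three, reconstruction_one_Q_three]
  rw [show 2 * (m + 1) - 2 = 2 * m by ring, show 2 * (m + 1) - 1 = 2 * m + 1 by ring,
    show 2 * m - 2 + 1 = 2 * m - 1 by ring, show 2 * m - 2 + 2 = 2 * m by ring,
    show 2 * m - 2 + 3 = 2 * m + 1 by ring]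
  push_cast
  rw [show t - 2 * (m : ℝ) - 2 + 2 = t - 2 * m by ring,
    show t - 2 * (m : ℝ) - 2 + 1 = t - (2 * m + 1) by ring,
    show t - 2 * (m : ℝ) + 2 = t - (2 * m - 2) by ring,
    show t - 2 * (m : ℝ) + 1 = t - (2 * m - 1) by ring]
  ring

end ShiftInvariant

/-! ### The operator as local Hermite interpolation; polynomial reproduction -/

/-- The quadratic spline with a knot at the midpoint of `[0, 2h]` and Hermite data
`(y₀, d₀)` and `(y₁, d₁)` at the ends, evaluated at `u h`. -/
noncomputable def hermiteSpline (y₀ d₀ y₁ d₁ : ℂ) (h u : ℝ) : ℂ :=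
  y₀ * reconstruction (Q 3) 0 2 0 u + h * d₀ * reconstruction (Q 3) 0 2 1 u +
    (y₁ * reconstruction (Q 3) 0 2 0 (u - 2) + h * d₁ * reconstruction (Q 3) 0 2 1 (u - 2))

theorem samplingOperator_Q_three (f : ℝ → ℂ) {W t : ℝ} {m : ℤ}
    (h : 2 * (m : ℝ) ≤ W * t) (h' : W * t ≤ 2 * m + 2) :
    samplingOperator (Q 3) 0 2 W f t =
      hermiteSpline (f (2 * m / W)) (deriv f (2 * m / W)) (f ((2 * m + 2) / W))
        (deriv f ((2 * m + 2) / W)) W⁻¹ (W * t - 2 * m) := by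
  have key := (hasSum_reconstruction_Q_three
    (fun l i => (1 / (W : ℂ) ^ (i : ℕ)) * iteratedDeriv (i : ℕ) f ((0 + ((2 : ℕ) : ℝ) * l) / W))
    h h').tsum_eq
  simp only [samplingOperator]
  simp only [Nat.cast_ofNat] at key ⊢
  rw [key, hermiteSpline]
  simp only [Fin.sum_univ_two, Fin.val_zero, Fin.val_one, iteratedDeriv_zero, iteratedDeriv_one,
    zero_add, pow_zero, pow_one]
  rw [show 2 * ((m + 1 : ℤ) : ℝ) = 2 * m + 2 by push_cast; ring]
  push_cast
  ring

theorem reconstruction_Q_three_of_mem_Icc_zero_one {u : ℝ} (h : 0 ≤ u) (h' : u ≤ 1) :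
    reconstruction (Q 3) 0 2 0 u = ((1 - u ^ 2 / 2 : ℝ) : ℂ) ∧
    reconstruction (Q 3) 0 2 1 u = ((u - 3 / 4 * u ^ 2 : ℝ) : ℂ) ∧
    reconstruction (Q 3) 0 2 0 (u - 2) = ((u ^ 2 / 2 : ℝ) : ℂ) ∧
    reconstruction (Q 3) 0 2 1 (u - 2) = ((-(u ^ 2 / 4) : ℝ) : ℂ) := by
  simp only [reconstruction_zero_Q_three, reconstruction_one_Q_three]
  rw [Q_three_of_mem_Icc_two_three (t := u + 2) (by linarith) (by linarith),
    Q_three_of_mem_Icc_one_two (t := u + 1) (by linarith) (by linarith),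
    Q_three_of_mem_Icc_zero_one (t := u - 2 + 2) (by linarith) (by linarith),
    Q_three_of_nonpos (t := u - 2 + 1) (by linarith)]
  refine ⟨?_, ?_, ?_, ?_⟩ <;> congr 1 <;> ring

/-- Mirror image of the left half under u ↦ 2 - u: the two nodes are exchanged and the slope
functions change sign. -/
theorem reconstruction_Q_three_of_mem_Icc_one_two {u : ℝ} (h : 1 ≤ u) (h' : u ≤ 2) :
    reconstruction (Q 3) 0 2 0 u = (((2 - u) ^ 2 / 2 : ℝ) : ℂ) ∧
    reconstruction (Q 3) 0 2 1 u = (((2 - u) ^ 2 / 4 : ℝ) : ℂ) ∧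
    reconstruction (Q 3) 0 2 0 (u - 2) = ((1 - (2 - u) ^ 2 / 2 : ℝ) : ℂ) ∧
    reconstruction (Q 3) 0 2 1 (u - 2) = ((3 / 4 * (2 - u) ^ 2 - (2 - u) : ℝ) : ℂ) := by
  simp only [reconstruction_zero_Q_three, reconstruction_one_Q_three]
  rw [Q_three_of_three_le (t := u + 2) (by linarith),
    Q_three_of_mem_Icc_two_three (t := u + 1) (by linarith) (by linarith),
    Q_three_of_mem_Icc_one_two (t := u - 2 + 2) (by linarith) (by linarith),
    Q_three_of_mem_Icc_zero_one (t := u - 2 + 1) (by linarith) (by linarith)]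
  refine ⟨?_, ?_, ?_, ?_⟩ <;> congr 1 <;> ring

theorem hermiteSpline_quadratic (A B C x : ℂ) (h : ℝ) {u : ℝ} (hu : 0 ≤ u) (hu' : u ≤ 2) :
    hermiteSpline (A + B * x + C * x ^ 2) (B + 2 * C * x)
      (A + B * (x + 2 * h) + C * (x + 2 * h) ^ 2) (B + 2 * C * (x + 2 * h)) h u =
    A + B * (x + u * h) + C * (x + u * h) ^ 2 := by
  rw [hermiteSpline]
  rcases le_total u 1 with h1 | h1
  · obtain ⟨e1, e2, e3, e4⟩ := reconstruction_Q_three_of_mem_Icc_zero_one hu h1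
    rw [e1, e2, e3, e4]
    push_cast; ring
  · obtain ⟨e1, e2, e3, e4⟩ := reconstruction_Q_three_of_mem_Icc_one_two h1 hu'
    rw [e1, e2, e3, e4]
    push_cast; ring

theorem norm_reconstruction_zero_Q_three_sub_two_le {u : ℝ} (hu : 0 ≤ u) (hu' : u ≤ 2) :
    ‖reconstruction (Q 3) 0 2 0 (u - 2)‖ ≤ 1 := by
  rcases le_total u 1 with h1 | h1
  · obtain ⟨-, -, e3, -⟩ := reconstruction_Q_three_of_mem_Icc_zero_one hu h1
    rw [e3, Complex.norm_real, Real.norm_eq_abs, abs_le]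
    constructor <;> nlinarith
  · obtain ⟨-, -, e3, -⟩ := reconstruction_Q_three_of_mem_Icc_one_two h1 hu'
    rw [e3, Complex.norm_real, Real.norm_eq_abs, abs_le]
    constructor <;> nlinarith

theorem samplingOperator_Q_three_polynomial (P : Polynomial ℂ) (hP : P.degree ≤ 2) {W : ℝ}
    (hW : 0 < W) (t : ℝ) :
    samplingOperator (Q 3) 0 2 W (fun s : ℝ => P.eval (s : ℂ)) t = P.eval (t : ℂ) := by
  have hm : (⌊W * t / 2⌋ : ℝ) ≤ W * t / 2 := Int.floor_le _
  have hm' : W * t / 2 < ⌊W * t / 2⌋ + 1 := Int.lt_floor_add_one _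
  set m := ⌊W * t / 2⌋
  have hev : ∀ z : ℂ, P.eval z = P.coeff 0 + P.coeff 1 * z + P.coeff 2 * z ^ 2 := by
    intro z
    rw [Polynomial.eval_eq_sum_range' (n := 3)
      (Nat.lt_succ_of_le (Polynomial.natDegree_le_of_degree_le hP))]
    simp [Finset.sum_range_succ]
  have hder : ∀ s : ℝ, deriv (fun s : ℝ => P.eval (s : ℂ)) s =
      P.coeff 1 + 2 * P.coeff 2 * s := by
    intro s
    have h2 := Polynomial.natDegree_derivative_le P
    have h3 : P.natDegree ≤ 2 := Polynomial.natDegree_le_of_degree_le hP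
    rw [((P.hasDerivAt (s : ℂ)).comp_ofReal).deriv,
      Polynomial.eval_eq_sum_range' (n := 2) (by omega)]
    simp only [Finset.sum_range_succ, Finset.sum_range_zero, Polynomial.coeff_derivative]
    push_cast; ring
  rw [samplingOperator_Q_three _ (m := m) (by linarith) (by linarith), hder, hder, hev, hev, hev]
  have hW' : (W : ℂ) ≠ 0 := by exact_mod_cast hW.ne'
  have := hermiteSpline_quadratic (P.coeff 0) (P.coeff 1) (P.coeff 2) ((2 * m / W : ℝ) : ℂ) W⁻¹
    (u := W * t - 2 * m) (by linarith) (by linarith)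
  rw [show ((2 * m / W : ℝ) : ℂ) + 2 * ((W⁻¹ : ℝ) : ℂ) = (((2 * m + 2) / W : ℝ) : ℂ) by
      push_cast; field_simp,
    show ((2 * m / W : ℝ) : ℂ) + ((W * t - 2 * m : ℝ) : ℂ) * ((W⁻¹ : ℝ) : ℂ) = (t : ℂ) by
      push_cast; field_simp; ring] at this
  exact this

/-! ### Whitney's inequality for a derivative -/

section Whitney

variable {E g : ℝ → ℂ} {a b ω : ℝ}

/-- A derivative is controlled by its second differences and by the values of the function. -/
theorem norm_smul_deriv_sub_le (hE : ∀ x, HasDerivAt E (g x) x)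
    (hω : ∀ x k : ℝ, x ∈ Set.Icc a b → x + 2 * k ∈ Set.Icc a b →
      ‖g x - 2 * g (x + k) + g (x + 2 * k)‖ ≤ ω)
    {x h : ℝ} (hx : x ∈ Set.Icc a b) (hh : x + 2 * h ∈ Set.Icc a b) :
    ‖h * g x - 2 * E (x + h) + 1 / 2 * E (x + 2 * h) + 3 / 2 * E x‖ ≤ ω * |h| := by
  -- This function of s has as derivative the second difference of g at x with step s. The mean
  -- value inequality replaces integration, since g need not be integrable; `uIcc` admits negative
  -- h.
  have hG : ∀ s ∈ Set.uIcc 0 h, HasDerivWithinAt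
      (fun s : ℝ => (s : ℂ) * g x - 2 * E (x + s) + 1 / 2 * E (x + 2 * s))
      (g x - 2 * g (x + s) + g (x + 2 * s)) (Set.uIcc 0 h) s := by
    intro s _
    have h1 : HasDerivAt (fun s : ℝ => (s : ℂ) * g x) (1 * g x) s :=
      (HasDerivAt.ofReal_comp (hasDerivAt_id s)).mul_const _
    have h2 : HasDerivAt (fun s : ℝ => E (x + s)) (g (x + s)) s := (hE (x + s)).comp_const_add x s
    have h3 : HasDerivAt (fun s : ℝ => E (x + 2 * s)) ((2 : ℝ) • g (x + 2 * s)) s := by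
      have : HasDerivAt (fun s : ℝ => x + 2 * s) 2 s := by
        simpa using ((hasDerivAt_id s).const_mul (2 : ℝ)).const_add x
      exact (hE (x + 2 * s)).scomp s this
    convert! ((h1.sub (h2.const_mul 2)).add (h3.const_mul (1 / 2))).hasDerivWithinAt using 1
    simp
  have hseg : ∀ s ∈ Set.uIcc 0 h, x + 2 * s ∈ Set.Icc a b := by
    intro s hs
    rw [Set.mem_uIcc] at hs
    obtain ⟨hx1, hx2⟩ := hx
    obtain ⟨hh1, hh2⟩ := hh
    constructor <;> rcases hs with hs | hs <;> linarith [hs.1, hs.2]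
  have key := (convex_uIcc (0 : ℝ) h).norm_image_sub_le_of_norm_hasDerivWithin_le hG
    (fun s hs => hω x s hx (hseg s hs)) Set.left_mem_uIcc Set.right_mem_uIcc
  rw [sub_zero, Real.norm_eq_abs] at key
  refine le_of_eq_of_le ?_ key
  congr 1
  simp
  ring

/-- The supremum argument for Whitney's inequality needs g bounded, which a derivative need not be.
Here E is bounded by compactness, and the previous estimate, with a step of length (b - a)/4
pointing towards the farther end, transfers this to g. -/
theorem exists_norm_deriv_le_of_secondDiff (hab : a < b) (hE : ∀ x, HasDerivAt E (g x) x)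
    (hω : ∀ x k : ℝ, x ∈ Set.Icc a b → x + 2 * k ∈ Set.Icc a b →
      ‖g x - 2 * g (x + k) + g (x + 2 * k)‖ ≤ ω) :
    ∃ M, ∀ x ∈ Set.Icc a b, ‖g x‖ ≤ M := by
  have hcont : Continuous E := continuous_iff_continuousAt.2 fun x => (hE x).continuousAt
  obtain ⟨B, hB⟩ := isCompact_Icc.exists_bound_of_continuousOn (hcont.continuousOn (s := Set.Icc a b))
  have main : ∀ x h : ℝ, x ∈ Set.Icc a b → x + 2 * h ∈ Set.Icc a b → |h| = (b - a) / 4 →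
      ‖g x‖ ≤ ω + 4 * B / ((b - a) / 4) := by
    intro x h hx hh hh'
    have hmid : x + h ∈ Set.Icc a b := by
      constructor <;> linarith [hx.1, hx.2, hh.1, hh.2]
    have hpos : 0 < |h| := by rw [hh']; linarith
    rw [← hh', ← sub_le_iff_le_add', le_div_iff₀ hpos, sub_mul]
    have h1 := norm_smul_deriv_sub_le hE hω hx hh
    have h2 : ‖(h : ℂ) * g x‖ = ‖g x‖ * |h| := by
      rw [norm_mul, Complex.norm_real, Real.norm_eq_abs, mul_comm]
    have h3 : (h : ℂ) * g x = (h * g x - 2 * E (x + h) + 1 / 2 * E (x + 2 * h) + 3 / 2 * E x) +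
        2 * E (x + h) - 1 / 2 * E (x + 2 * h) - 3 / 2 * E x := by ring
    have h4 : ‖(h : ℂ) * g x‖ ≤ ω * |h| + 2 * B + 1 / 2 * B + 3 / 2 * B := by
      rw [h3]
      refine (norm_sub_le _ _).trans (add_le_add ((norm_sub_le _ _).trans (add_le_add
        ((norm_add_le _ _).trans (add_le_add h1 ?_)) ?_)) ?_)
      · rw [norm_mul]; norm_num; exact hB _ hmid
      · rw [norm_mul]; norm_num; exact hB _ hh
      · rw [norm_mul]; norm_num; exact hB _ hx
    linarith
  refine ⟨ω + 4 * B / ((b - a) / 4), fun x hx => ?_⟩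
  obtain ⟨hx1, hx2⟩ := hx
  rcases le_total x ((a + b) / 2) with h | h
  · exact main x ((b - a) / 4) ⟨hx1, hx2⟩ ⟨by linarith, by linarith⟩ (abs_of_pos (by linarith))
  · refine main x (-((b - a) / 4)) ⟨hx1, hx2⟩ ⟨by linarith, by linarith⟩ ?_
    rw [abs_neg, abs_of_pos (by linarith)]

/-- Whitney's inequality of order two for a bounded function vanishing at the end points. -/
theorem norm_le_of_secondDiff (hM : ∃ M, ∀ x ∈ Set.Icc a b, ‖g x‖ ≤ M)
    (hω : ∀ x k : ℝ, x ∈ Set.Icc a b → x + 2 * k ∈ Set.Icc a b →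
      ‖g x - 2 * g (x + k) + g (x + 2 * k)‖ ≤ ω)
    (ha : g a = 0) (hb : g b = 0) {x : ℝ} (hx : x ∈ Set.Icc a b) : ‖g x‖ ≤ ω := by
  obtain ⟨M, hM⟩ := hM
  set S := sSup ((fun x => ‖g x‖) '' Set.Icc a b)
  have hS : ∀ y ∈ Set.Icc a b, ‖g y‖ ≤ S := fun y hy =>
    le_csSup ⟨M, by rintro _ ⟨z, hz, rfl⟩; exact hM z hz⟩ ⟨y, hy, rfl⟩
  -- Reflect the nearer end point in y: the image stays in [a, b], and g vanishes at the end point,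
  -- so 2‖g y‖ ≤ S + ω. The supremum S then satisfies S ≤ (ω + S)/2, that is S ≤ ω.
  have hhalf : ∀ y ∈ Set.Icc a b, ‖g y‖ ≤ (ω + S) / 2 := by
    intro y hy
    obtain ⟨hy1, hy2⟩ := hy
    have h2 : ‖2 * g y‖ = 2 * ‖g y‖ := by rw [norm_mul]; norm_num
    rcases le_total y ((a + b) / 2) with h | h
    · have hz : a + 2 * (y - a) ∈ Set.Icc a b := ⟨by linarith, by linarith⟩
      have h1 := hω a (y - a) ⟨le_rfl, by linarith⟩ hz
      rw [ha, add_sub_cancel a y] at h1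
      have h3 : 2 * g y = g (a + 2 * (y - a)) - (0 - 2 * g y + g (a + 2 * (y - a))) := by ring
      have h4 := norm_sub_le (g (a + 2 * (y - a))) (0 - 2 * g y + g (a + 2 * (y - a)))
      rw [← h3, h2] at h4
      linarith [hS _ hz]
    · have hz : b + 2 * (y - b) ∈ Set.Icc a b := ⟨by linarith, by linarith⟩
      have h1 := hω b (y - b) ⟨by linarith, le_rfl⟩ hz
      rw [hb, add_sub_cancel b y] at h1
      have h3 : 2 * g y = g (b + 2 * (y - b)) - (0 - 2 * g y + g (b + 2 * (y - b))) := by ring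
      have h4 := norm_sub_le (g (b + 2 * (y - b))) (0 - 2 * g y + g (b + 2 * (y - b)))
      rw [← h3, h2] at h4
      linarith [hS _ hz]
  have hSle : S ≤ (ω + S) / 2 :=
    csSup_le ⟨_, x, hx, rfl⟩ (by rintro _ ⟨z, hz, rfl⟩; exact hhalf z hz)
  linarith [hS x hx]

theorem norm_le_of_secondDiff_deriv (hab : a < b) (hE : ∀ x, HasDerivAt E (g x) x)
    (hω : ∀ x k : ℝ, x ∈ Set.Icc a b → x + 2 * k ∈ Set.Icc a b →
      ‖g x - 2 * g (x + k) + g (x + 2 * k)‖ ≤ ω)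
    (hEa : E a = 0) (ha : g a = 0) (hb : g b = 0) {x : ℝ} (hx : x ∈ Set.Icc a b) :
    ‖E x‖ ≤ ω * (x - a) := by
  have hbd := exists_norm_deriv_le_of_secondDiff hab hE hω
  have := (convex_Icc a b).norm_image_sub_le_of_norm_hasDerivWithin_le
    (fun y _ => (hE y).hasDerivWithinAt)
    (fun y hy => norm_le_of_secondDiff hbd hω ha hb hy) ⟨le_rfl, hab.le⟩ hx
  rwa [hEa, sub_zero, Real.norm_eq_abs, abs_of_nonneg (by linarith [hx.1])] at this

end Whitney

/-! ### Pointwise error estimate -/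

theorem norm_hermiteSpline_sub_le {f g : ℝ → ℂ} {a h ω u : ℝ} (hh : 0 < h)
    (hf : ∀ x, HasDerivAt f (g x) x)
    (hω : ∀ x k : ℝ, x ∈ Set.Icc a (a + 2 * h) → x + 2 * k ∈ Set.Icc a (a + 2 * h) →
      ‖g x - 2 * g (x + k) + g (x + 2 * k)‖ ≤ ω)
    (hu : 0 ≤ u) (hu' : u ≤ 2) :
    ‖hermiteSpline (f a) (g a) (f (a + 2 * h)) (g (a + 2 * h)) h u - f (a + u * h)‖ ≤
      4 * h * ω := by
  have hh' : (h : ℂ) ≠ 0 := by exact_mod_cast hh.ne'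
  -- The quadratic A + Bx + Cx² matches f at a and g at both ends; its value at a + 2h is left
  -- unmatched.
  obtain ⟨C, hC⟩ : ∃ C : ℂ, C = (g (a + 2 * h) - g a) / (4 * h) := ⟨_, rfl⟩
  obtain ⟨B, hB⟩ : ∃ B : ℂ, B = g a - 2 * C * a := ⟨_, rfl⟩
  obtain ⟨A, hA⟩ : ∃ A : ℂ, A = f a - B * a - C * a ^ 2 := ⟨_, rfl⟩
  have hga : g a = B + 2 * C * a := by rw [hB]; ring
  have hgb : g (a + 2 * h) = B + 2 * C * (a + 2 * h) := by
    rw [hB, hC]; field_simp; ring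
  have hfa : f a = A + B * a + C * a ^ 2 := by rw [hA]; ring
  have hE : ∀ x : ℝ, HasDerivAt (fun x : ℝ => f x - (A + B * x + C * (x : ℂ) ^ 2))
      (g x - (B + 2 * C * x)) x := by
    intro x
    have h1 : HasDerivAt (fun x : ℝ => (x : ℂ)) 1 x := HasDerivAt.ofReal_comp (hasDerivAt_id x)
    convert! (hf x).sub (((h1.const_mul B).const_add A).add ((h1.pow 2).const_mul C)) using 1
    simp
    ring
  have bound : ∀ x ∈ Set.Icc a (a + 2 * h),
      ‖f x - (A + B * x + C * (x : ℂ) ^ 2)‖ ≤ ω * (x - a) := by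
    intro x hx
    refine norm_le_of_secondDiff_deriv (b := a + 2 * h) (by linarith) hE ?_ ?_ ?_ ?_ hx
    · intro y k hy hk
      refine le_of_eq_of_le ?_ (hω y k hy hk)
      congr 1
      push_cast; ring
    · rw [hfa]; ring
    · rw [hga]; ring
    · rw [hgb]; push_cast; ring
  have h0 : 0 ≤ ω := (norm_nonneg _).trans
    (hω a 0 ⟨le_rfl, by linarith⟩ ⟨by linarith, by linarith⟩)
  have hb := bound (a + 2 * h) ⟨by linarith, le_rfl⟩
  have hx := bound (a + u * h) ⟨by nlinarith, by nlinarith⟩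
  have hq := hermiteSpline_quadratic A B C a h hu hu'
  -- The quadratic is reproduced, so only its remainder is interpolated, and the sole nonzero datum
  -- of that remainder is its value at the right end. Each of the two terms is at most 2hω.
  have hdecomp : hermiteSpline (f a) (g a) (f (a + 2 * h)) (g (a + 2 * h)) h u - f (a + u * h) =
      (f (a + 2 * h) - (A + B * ((a + 2 * h : ℝ) : ℂ) + C * ((a + 2 * h : ℝ) : ℂ) ^ 2)) *
        reconstruction (Q 3) 0 2 0 (u - 2) -
      (f (a + u * h) - (A + B * ((a + u * h : ℝ) : ℂ) + C * ((a + u * h : ℝ) : ℂ) ^ 2)) := by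
    push_cast
    rw [sub_sub_eq_add_sub, ← hq, hga, hgb, hfa]
    simp only [hermiteSpline]
    ring
  rw [hdecomp]
  have hΘ := norm_reconstruction_zero_Q_three_sub_two_le hu hu'
  have h1 := norm_sub_le
    ((f (a + 2 * h) - (A + B * ((a + 2 * h : ℝ) : ℂ) + C * ((a + 2 * h : ℝ) : ℂ) ^ 2)) *
        reconstruction (Q 3) 0 2 0 (u - 2))
    (f (a + u * h) - (A + B * ((a + u * h : ℝ) : ℂ) + C * ((a + u * h : ℝ) : ℂ) ^ 2))
  rw [norm_mul] at h1
  have h2 := mul_le_mul hb hΘ (norm_nonneg _) ((norm_nonneg _).trans hb)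
  have h3 : ω * (a + u * h - a) ≤ ω * (2 * h) :=
    mul_le_mul_of_nonneg_left (by nlinarith) h0
  linarith

theorem enorm_samplingOperator_Q_three_sub_le {f : ℝ → ℂ} (hf : Differentiable ℝ f) {W : ℝ}
    (hW : 0 < W) (t : ℝ) :
    ‖samplingOperator (Q 3) 0 2 W f t - f t‖ₑ ≤
      ENNReal.ofReal (4 / W) * localModulus 2 (deriv f) t (2 / W) := by
  have hW4 : 0 < 4 / W := by positivity
  by_cases htop : localModulus 2 (deriv f) t (2 / W) = ∞
  · rw [htop, ENNReal.mul_top (by simpa using hW4)]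
    exact le_top
  have hm : (⌊W * t / 2⌋ : ℝ) ≤ W * t / 2 := Int.floor_le _
  have hm' : W * t / 2 < ⌊W * t / 2⌋ + 1 := Int.lt_floor_add_one _
  set m := ⌊W * t / 2⌋
  have hinv : 0 < W⁻¹ := by positivity
  have ht : 2 * m / W + (W * t - 2 * m) * W⁻¹ = t := by field_simp; ring
  have ha : 2 * m / W ≤ t := by
    rw [div_le_iff₀ hW]; linarith
  have hb : t ≤ 2 * m / W + 2 * W⁻¹ := by
    rw [← div_eq_mul_inv, ← add_div, le_div_iff₀ hW]; linarith
  -- The cell has length 2/W and contains t, so it lies within distance 2/W of t, the radius rδ/2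
  -- for r = 2 and δ = 2/W.
  have hsub : Set.Icc (2 * m / W) (2 * m / W + 2 * W⁻¹) ⊆
      Set.Icc (t - (2 : ℕ) * (2 / W) / 2) (t + (2 : ℕ) * (2 / W) / 2) := by
    rintro y ⟨hy1, hy2⟩
    rw [div_eq_mul_inv 2 W]
    push_cast
    constructor <;> linarith
  have key := norm_hermiteSpline_sub_le (f := f) (g := deriv f) (a := 2 * m / W) (h := W⁻¹)
    (ω := (localModulus 2 (deriv f) t (2 / W)).toReal) (u := W * t - 2 * m) hinv
    (fun x => (hf x).hasDerivAt) ?_ (by linarith) (by linarith)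
  · rw [ht, show 2 * m / W + 2 * W⁻¹ = (2 * m + 2) / W by field_simp,
      ← samplingOperator_Q_three f (by linarith) (by linarith)] at key
    rw [← ofReal_norm, ← ENNReal.ofReal_toReal htop, ← ENNReal.ofReal_mul hW4.le]
    refine ENNReal.ofReal_le_ofReal ?_
    rwa [div_eq_mul_inv]
  · intro x k hx hk
    have h1 : ‖forwardDiff 2 k (deriv f) x‖ₑ ≤ localModulus 2 (deriv f) t (2 / W) :=
      le_iSup_of_le x (le_iSup_of_le k (le_iSup_of_le (hsub hx)
        (le_iSup_of_le (by push_cast; simpa using hsub hk) le_rfl)))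
    have h2 : forwardDiff 2 k (deriv f) x =
        deriv f x - 2 * deriv f (x + k) + deriv f (x + 2 * k) := by
      simp [forwardDiff, Finset.sum_range_succ]
      ring
    rw [← h2, ← toReal_enorm]
    exact ENNReal.toReal_mono htop h1

/-! ### Measurability and the rate in L^p -/

theorem continuous_reconstruction_Q_three (i : Fin 2) :
    Continuous (reconstruction (Q 3) 0 2 i) := by
  have := continuous_Q_three
  rw [show reconstruction (Q 3) 0 2 i = _ from funext (reconstruction_Q_three i)]
  fun_prop

theorem continuous_hermiteSpline (y₀ d₀ y₁ d₁ : ℂ) (h : ℝ) :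
    Continuous (hermiteSpline y₀ d₀ y₁ d₁ h) := by
  have h0 := continuous_reconstruction_Q_three 0
  have h1 := continuous_reconstruction_Q_three 1
  have hs : Continuous fun u : ℝ => u - 2 := continuous_sub_right 2
  exact ((continuous_const.mul h0).add (continuous_const.mul h1)).add
    ((continuous_const.mul (h0.comp hs)).add (continuous_const.mul (h1.comp hs)))

/-- For a fixed cell index the formula is continuous in the point, and the index is a measurable
function with countably many values; nothing is needed of the samples. -/
theorem measurable_samplingOperator_Q_three (f : ℝ → ℂ) (W : ℝ) :
    Measurable (samplingOperator (Q 3) 0 2 W f) := by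
  obtain ⟨F, hF⟩ : ∃ F : ℤ × ℝ → ℂ, ∀ m x, F (m, x) =
      hermiteSpline (f (2 * m / W)) (deriv f (2 * m / W)) (f ((2 * m + 2) / W))
        (deriv f ((2 * m + 2) / W)) W⁻¹ (x - 2 * m) :=
    ⟨fun q => hermiteSpline (f (2 * q.1 / W)) (deriv f (2 * q.1 / W)) (f ((2 * q.1 + 2) / W))
      (deriv f ((2 * q.1 + 2) / W)) W⁻¹ (q.2 - 2 * q.1), fun m x => rfl⟩
  have heq : samplingOperator (Q 3) 0 2 W f = fun t => F (⌊W * t / 2⌋, W * t) := by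
    ext t
    have hm : (⌊W * t / 2⌋ : ℝ) ≤ W * t / 2 := Int.floor_le _
    have hm' : W * t / 2 < ⌊W * t / 2⌋ + 1 := Int.lt_floor_add_one _
    rw [hF, samplingOperator_Q_three f (by linarith) (by linarith)]
  have hmeas : Measurable F := by
    refine measurable_from_prod_countable_right fun m => ?_
    simp only [hF]
    exact ((continuous_hermiteSpline _ _ _ _ _).comp (continuous_sub_right _)).measurable
  rw [heq]
  exact hmeas.comp (((measurable_id.const_mul W).div_const 2).floor.prodMk
    (measurable_id.const_mul W))

/-- Every point x lies on an admissible partition, namely x + ℤ. -/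
theorem differentiable_of_mem_Lam {p : ℝ} {f : ℝ → ℂ} (hf : f ∈ Lam 2 p) :
    Differentiable ℝ f := by
  intro x
  have := (hf.2.2 (fun j => x + j) ⟨1, 1, one_pos, fun j => by
    push_cast; constructor <;> linarith⟩).1 0 0 (by norm_num)
  simpa using this

theorem exists_eLpNorm_samplingOperator_Q_three_sub_le {p α : ℝ} {f : ℝ → ℂ}
    (hf : Differentiable ℝ f)
    (hτ : ∃ C : ℝ, ∀ᶠ δ in 𝓝[>] (0 : ℝ),
      averagedModulus 2 (deriv f) δ p ≤ ENNReal.ofReal (C * δ ^ α)) :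
    ∃ C : ℝ, ∀ᶠ W : ℝ in atTop,
      MemLp (fun t => samplingOperator (Q 3) 0 2 W f t - f t) (ENNReal.ofReal p) volume ∧
      eLpNorm (fun t => samplingOperator (Q 3) 0 2 W f t - f t) (ENNReal.ofReal p) volume ≤
        ENNReal.ofReal (C * W ^ (-α)) := by
  obtain ⟨C, hC⟩ := hτ
  have htend : Tendsto (fun W : ℝ => 2 / W) atTop (𝓝[>] 0) := by
    refine tendsto_nhdsWithin_iff.2 ⟨tendsto_const_nhds.div_atTop tendsto_id, ?_⟩
    filter_upwards [eventually_gt_atTop 0] with W hW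
    exact div_pos two_pos hW
  -- The bound (4/W) C (2/W)^α, with 4/W ≤ 4 for W ≥ 1 and C replaced by |C| because its sign is
  -- unknown.
  refine ⟨4 * (|C| * 2 ^ α), ?_⟩
  filter_upwards [htend.eventually hC, eventually_ge_atTop 1] with W hW hW1
  have hW0 : 0 < W := by linarith
  have hle : eLpNorm (fun t => samplingOperator (Q 3) 0 2 W f t - f t) (ENNReal.ofReal p) volume ≤
      ENNReal.ofReal (4 * (|C| * 2 ^ α) * W ^ (-α)) := by
    have h1 : eLpNorm (fun t => samplingOperator (Q 3) 0 2 W f t - f t) (ENNReal.ofReal p) volume ≤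
        ENNReal.ofReal (4 / W) * averagedModulus 2 (deriv f) (2 / W) p :=
      eLpNorm_le_mul_eLpNorm_of_ae_le_mul' (c := (4 / W).toNNReal)
        (g := fun x => localModulus 2 (deriv f) x (2 / W))
        (Eventually.of_forall fun t => enorm_samplingOperator_Q_three_sub_le hf hW0 t) _
    refine h1.trans ((mul_le_mul_right hW _).trans ?_)
    rw [← ENNReal.ofReal_mul (by positivity)]
    refine ENNReal.ofReal_le_ofReal ?_
    rw [Real.div_rpow zero_le_two hW0.le, Real.rpow_neg hW0.le, mul_assoc 4, mul_assoc |C|,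
      ← div_eq_mul_inv]
    calc 4 / W * (C * (2 ^ α / W ^ α)) ≤ 4 / W * (|C| * (2 ^ α / W ^ α)) := by
          gcongr; exact le_abs_self C
      _ ≤ 4 * (|C| * (2 ^ α / W ^ α)) := by
          refine mul_le_mul_of_nonneg_right ?_ (by positivity)
          rw [div_le_iff₀ hW0]; linarith
  refine ⟨⟨?_, hle.trans_lt ENNReal.ofReal_lt_top⟩, hle⟩
  exact ((measurable_samplingOperator_Q_three f W).sub
    hf.continuous.measurable).aestronglyMeasurable

end DerivSampling

theorem mainTheorem9 :
    -- the reconstruction functions are explicit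
    ((∀ t : ℝ, reconstruction (Q 3) 0 2 0 t = ((Q 3 (t + 2) + Q 3 (t + 1) : ℝ) : ℂ)) ∧
      (∀ t : ℝ, reconstruction (Q 3) 0 2 1 t =
        ((-(1 / 2) * Q 3 (t + 2) + 1 / 2 * Q 3 (t + 1) : ℝ) : ℂ))) ∧
    -- they reconstruct every element of the spline space from its derivative samples
    (∀ f ∈ shiftInvariantSpace (Q 3), Differentiable ℝ f ∧ ∀ t : ℝ,
      HasSum (fun l : ℤ => ∑ i : Fin 2,
        iteratedDeriv (i : ℕ) f (2 * l) * reconstruction (Q 3) 0 2 i (t - 2 * l)) (f t)) ∧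
    -- the operator reproduces polynomials of degree at most two
    (∀ P : Polynomial ℂ, P.degree ≤ 2 → ∀ W : ℝ, 0 < W → ∀ t : ℝ,
      samplingOperator (Q 3) 0 2 W (fun s : ℝ => P.eval (s : ℂ)) t = P.eval (t : ℂ)) ∧
    -- the rate of approximation
    (∀ p : ℝ, 1 ≤ p → ∀ α : ℝ, 0 < α → ∀ f ∈ Lam 2 p,
      (∀ i : ℕ, i < 2 → ∃ C : ℝ, ∀ᶠ δ in 𝓝[>] (0 : ℝ),
        averagedModulus 2 (iteratedDeriv i f) δ p ≤ ENNReal.ofReal (C * δ ^ α)) →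
      ∃ C : ℝ, ∀ᶠ W : ℝ in atTop,
        MemLp (fun t => samplingOperator (Q 3) 0 2 W f t - f t) (ENNReal.ofReal p) volume ∧
        eLpNorm (fun t => samplingOperator (Q 3) 0 2 W f t - f t) (ENNReal.ofReal p) volume ≤
          ENNReal.ofReal (C * W ^ (-α))) := by
  refine ⟨⟨reconstruction_zero_Q_three, reconstruction_one_Q_three⟩, ?_, ?_, ?_⟩
  · rintro f ⟨-, c, -, hf⟩
    exact ⟨differentiable_of_hasSum_Q_three hf, hasSum_reconstruction_of_hasSum_Q_three hf⟩
  · intro P hP W hW t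
    exact samplingOperator_Q_three_polynomial P hP hW t
  · intro p _ α _ f hf hτ
    refine exists_eLpNorm_samplingOperator_Q_three_sub_le (differentiable_of_mem_Lam hf) ?_
    simpa using hτ 1 one_lt_two
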